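/- Let $(\Omega,\mathcal F,\mathbb P)$ be a probability space and let $\rho\in L^2$ (the stochastic discount factor) satisfy $\mathbb P(\rho>0)=1$ and $\mathrm{Var}[\rho]>0$. Let $a\le b$ and $p\in(0,1)$, and let the benchmark $X_0$ have law $p\,\delta_a+(1-p)\,\delta_b$, so that $\mathrm E[X_0]=pa+(1-p)b$. Write $X\succeq_{\mathrm{icx}}Y$ if $\mathrm E[f(X)]\ge\mathrm E[f(Y)]$ for every increasing convex $f:\mathbb R\to\mathbb R$ for which the expectations exist. For $x\in\mathbb R$, a payoff is called variance-minimal if it minimizes $\mathrm{Var}[X]$ over all $X\in L^2$ with $\mathrm E[\rho X]\le x$ and $X\succeq_{\mathrm{icx}}X_0$. Let $Q_\rho(t)=\inf\{y\in\mathbb R:\mathbb P(\rho\le y)>t\}$ for $t\in[0,1)$, let $q=Q_\rho((1-p)-)$ be its left limit at $1-p$, and put $$A_1=\frac1p\int_0^pQ_\rho(1-s)\,ds,\qquad A_2=\frac1{1-p}\int_p^1Q_\rho(1-s)\,ds,$$ $$D=(1-p)\mathrm E[\rho^2]+p^2A_1^2-(1-p)^2A_2^2 .$$ Then the following holds. (a)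 If $x\le \mathrm E[X_0]\mathrm E[\rho]-\frac{b-a}{A_1-A_2}\mathrm{Var}[\rho]$, then there is an a.s. unique variance-minimal payoff $X^\circ$, namely $$X^\circ=\mathrm E[X_0]+\frac{\mathrm E[X_0]\mathrm E[\rho]-x}{\mathrm{Var}[\rho]}\mathrm E[\rho]-\frac{\mathrm E[X_0]\mathrm E[\rho]-x}{\mathrm{Var}[\rho]}\,\rho\quad\text{a.s.}$$ Assume for (b) and (c) that $\mathbb P(\rho\le q)=1-p$ (which holds, for instance, if $\rho$ has no atom at $q$). (b) If $\mathrm E[X_0]\mathrm E[\rho]-\frac{b-a}{A_1-A_2}\mathrm{Var}[\rho]<x\le b\,\mathrm E[\rho]-\frac{b-a}{A_1}D$, then there is an a.s. unique variance-minimal payoff $X^\circ$, namely, with $k=\dfrac{apA_1+b(1-p)A_2-x}{\mathrm E[\rho^2]-pA_1^2-(1-p)A_2^2}$, $$X^\circ=\begin{cases}a+kA_1-k\rho&\text{if }\rho>q,\\ b+kA_2-k\rho&\text{if }\rho\le q,\end{cases}\quad\text{a.s.}$$ (c) If $b\,\mathrm E[\rho]-\frac{b-a}{A_1}D<x<b\,\mathrm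 E[\rho]$, then there is an a.s. unique variance-minimal payoff $X^\circ$, namely $$X^\circ=\begin{cases}b-\dfrac{p\,(b\mathrm E[\rho]-x)}{D}A_1-\dfrac{(1-p)(b\mathrm E[\rho]-x)}{D}\,\rho&\text{if }\rho>q,\\[2mm] b+\dfrac{(1-p)(b\mathrm E[\rho]-x)}{D}A_2-\dfrac{(1-p)(b\mathrm E[\rho]-x)}{D}\,\rho&\text{if }\rho\le q,\end{cases}\quad\text{a.s.}$$ -/

import Mathlib

open MeasureTheory ProbabilityTheory

/-- The upper quantile function `Q_X(t) = inf {x | P(X ≤ x) > t}`, for `t ∈ [0, 1)`. -/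
noncomputable def upperQuantile {Ω : Type*} [MeasurableSpace Ω] (P : Measure Ω) (X : Ω → ℝ)
    (t : ℝ) : ℝ :=
  sInf {x : ℝ | t < P.real {ω | X ω ≤ x}}

/-- `X` dominates `Y` in the increasing convex order: `E[f(Y)] ≤ E[f(X)]` for every increasing
convex `f : ℝ → ℝ` for which the expectations exist. -/
def IcxDominates {Ω : Type*} [MeasurableSpace Ω] (P : Measure Ω) (X Y : Ω → ℝ) : Prop :=
  ∀ f : ℝ → ℝ, Monotone f → ConvexOn ℝ Set.univ f →
    Integrable (fun ω => f (X ω)) P → Integrable (fun ω => f (Y ω)) P →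
      ∫ ω, f (Y ω) ∂P ≤ ∫ ω, f (X ω) ∂P

/-- The square-integrable payoffs affordable with capital `x` under the stochastic discount
factor `ρ` that beat the benchmark `X₀` in the increasing convex order. -/
def icxFeasible {Ω : Type*} [MeasurableSpace Ω] (P : Measure Ω) (ρ : Ω → ℝ) (x : ℝ)
    (X₀ : Ω → ℝ) : Set (Ω → ℝ) :=
  {X | MemLp X 2 P ∧ ∫ ω, ρ ω * X ω ∂P ≤ x ∧ IcxDominates P X X₀}

/-- `X` is a feasible payoff of least variance among all feasible payoffs. -/
def IsVarianceMinimal {Ω : Type*} [MeasurableSpace Ω] (P : Measure Ω) (ρ : Ω → ℝ) (x : ℝ)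
    (X₀ X : Ω → ℝ) : Prop :=
  X ∈ icxFeasible P ρ x X₀ ∧ ∀ Y ∈ icxFeasible P ρ x X₀, Var[X; P] ≤ Var[Y; P]

/-! For a two-point benchmark the order constraint reduces to two linear conditions. Domination
forces `E[X] ≥ p a + (1-p) b` and `E[(X-c)⁺] ≥ (1-p)(b-c)` for every `c`. Conversely, the mean bound
together with `E[φ X] ≥ (1-p) b` for one weight `0 ≤ φ ≤ 1` of mass `1-p` gives domination, by the
tangents of `f` at `a` and `b` (`icxDominates_of_weight`).

Optimality is Lagrangian duality. With multiplier `k` for the budget and `d` for the call constraint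
at one well-chosen strike, the Lagrangian is minimized pointwise in `ω` by `μ - k ρ`, raised by `d`
where `ρ ≤ q` (`lagrangian_raisedPayoff_le`). A competitor is first translated to the mean of the
candidate, which turns variance into second moment; equality in the Lagrangian then forces a.s.
equality, hence uniqueness (`ae_eq_add_of_variance_le`).

The three regimes are the possible sets of binding constraints besides the budget: in (a) the mean
alone (`d = 0`), in (b) mean and upper tail, in (c) the upper tail alone. `A₁` and `A₂` enter as the
upper and lower tail means of `ρ`, expressed through weights by `tailMean_lower` and
`tailMean_upper`. -/

/-! ### Quantile functions and their integrals. -/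

section Quantile

open Set Filter Topology

/-- The upper quantile function only depends on the law. -/
lemma upperQuantile_eq_map {Ω : Type*} [MeasurableSpace Ω] {P : Measure Ω} {X : Ω → ℝ}
    (hX : AEMeasurable X P) : upperQuantile P X = upperQuantile (P.map X) id := by
  funext t
  have h : ∀ x : ℝ, P.real {ω | X ω ≤ x} = (P.map X).real {y | id y ≤ x} := fun x => by
    have hm : MeasurableSet {y : ℝ | id y ≤ x} := measurableSet_Iic
    rw [Measure.real, Measure.real, Measure.map_apply_of_aemeasurable hX hm]
    rfl
  simp only [upperQuantile, h]

variable {μ : Measure ℝ}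

lemma upperQuantile_id [IsProbabilityMeasure μ] (t : ℝ) : upperQuantile μ id t = sInf {x | t < cdf μ x} := by
  simp only [upperQuantile, cdf_eq_real]
  rfl

lemma bddBelow_lt_cdf {t : ℝ} (ht : 0 < t) : BddBelow {x | t < cdf μ x} := by
  obtain ⟨y, hy⟩ := ((tendsto_cdf_atBot μ).eventually_lt_const ht).exists
  refine ⟨y, fun x hx => ?_⟩
  by_contra! h
  exact absurd (hx.trans_le (monotone_cdf μ h.le)) hy.not_gt

lemma nonempty_lt_cdf {t : ℝ} (ht : t < 1) : {x | t < cdf μ x}.Nonempty :=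
  ((tendsto_cdf_atTop μ).eventually_const_lt ht).exists

variable [IsProbabilityMeasure μ]

lemma upperQuantile_le_of_lt_cdf {t y : ℝ} (ht : 0 < t) (h : t < cdf μ y) :
    upperQuantile μ id t ≤ y := by
  rw [upperQuantile_id]
  exact csInf_le (bddBelow_lt_cdf ht) h

/-- Right continuity of the cdf passes the bound from points `z > y` down to `y`. With the previous
lemma this replaces a Galois connection, up to the boundary case `t = cdf μ y`. -/
lemma le_cdf_of_upperQuantile_le {t y : ℝ} (ht : t < 1) (h : upperQuantile μ id t ≤ y) :
    t ≤ cdf μ y := by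
  rw [upperQuantile_id] at h
  have hc : Tendsto (cdf μ) (𝓝[>] y) (𝓝 (cdf μ y)) :=
    ((cdf μ).right_continuous y).mono_left (nhdsWithin_mono _ Ioi_subset_Ici_self)
  refine ge_of_tendsto hc ?_
  filter_upwards [self_mem_nhdsWithin] with z hz
  obtain ⟨w, hw, hwz⟩ := exists_lt_of_csInf_lt (nonempty_lt_cdf ht) (h.trans_lt hz)
  exact (hw.trans_le (monotone_cdf μ hwz.le)).le

lemma monotoneOn_upperQuantile : MonotoneOn (upperQuantile μ id) (Ioo 0 1) := by
  intro s hs t ht hst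
  rw [upperQuantile_id, upperQuantile_id]
  exact csInf_le_csInf (bddBelow_lt_cdf hs.1) (nonempty_lt_cdf ht.2) fun x hx => hst.trans_lt hx

lemma aemeasurable_upperQuantile :
    AEMeasurable (upperQuantile μ id) (volume.restrict (Ioo (0 : ℝ) 1)) :=
  aemeasurable_restrict_of_monotoneOn measurableSet_Ioo monotoneOn_upperQuantile

/-- The upper quantile function pushes the uniform law on `(0, 1)` forward to the given law. -/
lemma map_upperQuantile : (volume.restrict (Ioo (0 : ℝ) 1)).map (upperQuantile μ id) = μ := by
  have : IsFiniteMeasure (volume.restrict (Ioo (0 : ℝ) 1)) := ⟨by simp⟩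
  refine Measure.ext_of_Iic _ _ fun y => ?_
  rw [Measure.map_apply_of_aemeasurable aemeasurable_upperQuantile measurableSet_Iic,
    Measure.restrict_apply' measurableSet_Ioo, ← ofReal_cdf]
  -- Up to one endpoint the preimage of `Iic y` is the interval from `0` to `cdf μ y`, so it is
  -- squeezed between the open and the half-open one.
  apply le_antisymm
  · calc volume (upperQuantile μ id ⁻¹' Iic y ∩ Ioo 0 1) ≤ volume (Ioc 0 (cdf μ y)) :=
          measure_mono fun t ht => ⟨ht.2.1, le_cdf_of_upperQuantile_le ht.2.2 ht.1⟩
      _ = ENNReal.ofReal (cdf μ y) := by simp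
  · calc ENNReal.ofReal (cdf μ y) = volume (Ioo 0 (cdf μ y)) := by simp
      _ ≤ volume (upperQuantile μ id ⁻¹' Iic y ∩ Ioo 0 1) := measure_mono fun t ht =>
          ⟨upperQuantile_le_of_lt_cdf ht.1 ht.2, ht.1, ht.2.trans_le (cdf_le_one μ y)⟩

lemma isLUB_leftLim_upperQuantile {r : ℝ} (hr0 : 0 < r) (hr1 : r < 1) :
    IsLUB (upperQuantile μ id '' Ioo 0 r) (Function.leftLim (upperQuantile μ id) r) := by
  have hne : (upperQuantile μ id '' Ioo 0 r).Nonempty := (nonempty_Ioo.2 hr0).image _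
  have hmono : MonotoneOn (upperQuantile μ id) (Ioo 0 r) :=
    monotoneOn_upperQuantile.mono (Ioo_subset_Ioo_right hr1.le)
  have hb : BddAbove (upperQuantile μ id '' Ioo 0 r) := by
    refine ⟨upperQuantile μ id r, ?_⟩
    rintro _ ⟨t, ht, rfl⟩
    exact monotoneOn_upperQuantile ⟨ht.1, ht.2.trans hr1⟩ ⟨hr0, hr1⟩ ht.2.le
  have hl := isLUB_csSup hne hb
  have ht : Tendsto (upperQuantile μ id) (𝓝[<] r) (𝓝 (sSup (upperQuantile μ id '' Ioo 0 r))) := by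
    -- Monotonicity holds only on `(0, 1)`, since the infimum may take junk values outside; the left
    -- neighbourhood is cut down to `Ioo 0 r`.
    rw [← nhdsWithin_Ioo_eq_nhdsLT hr0]
    refine tendsto_order.2 ⟨fun c hc => ?_, fun c hc => ?_⟩
    · obtain ⟨_, ⟨t, ht, rfl⟩, hct⟩ := exists_lt_of_lt_csSup hne hc
      have : Ioo t r ∈ 𝓝[Ioo 0 r] r := by
        rw [nhdsWithin_Ioo_eq_nhdsLT hr0]
        exact Ioo_mem_nhdsLT ht.2
      filter_upwards [this, self_mem_nhdsWithin] with s hs hs'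
      exact hct.trans_le (hmono ht hs' hs.1.le)
    · filter_upwards [self_mem_nhdsWithin] with s hs
      exact (hl.1 (mem_image_of_mem _ hs)).trans_lt hc
  rwa [leftLim_eq_of_tendsto ht]

lemma upperQuantile_le_leftLim {r t : ℝ} (hr1 : r < 1) (ht : t ∈ Ioo 0 r) :
    upperQuantile μ id t ≤ Function.leftLim (upperQuantile μ id) r :=
  (isLUB_leftLim_upperQuantile (ht.1.trans ht.2) hr1).1 (mem_image_of_mem _ ht)

lemma leftLim_le_upperQuantile {r t : ℝ} (hr0 : 0 < r) (hrt : r ≤ t) (ht : t < 1) :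
    Function.leftLim (upperQuantile μ id) r ≤ upperQuantile μ id t := by
  refine (isLUB_leftLim_upperQuantile hr0 (hrt.trans_lt ht)).2 ?_
  rintro _ ⟨s, hs, rfl⟩
  exact monotoneOn_upperQuantile ⟨hs.1, (hs.2.trans_le hrt).trans ht⟩
    ⟨hr0.trans_le hrt, ht⟩ (hs.2.le.trans hrt)

lemma measureReal_Iio_leftLim_le {r : ℝ} (hr0 : 0 < r) :
    μ.real (Iio (Function.leftLim (upperQuantile μ id) r)) ≤ r := by
  refine ENNReal.toReal_le_of_le_ofReal hr0.le ?_
  set q := Function.leftLim (upperQuantile μ id) r with hq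
  nth_rw 1 [← map_upperQuantile (μ := μ)]
  rw [Measure.map_apply_of_aemeasurable aemeasurable_upperQuantile measurableSet_Iio,
    Measure.restrict_apply' measurableSet_Ioo]
  calc _ ≤ volume (Ioo 0 r) := measure_mono fun t ht => ⟨ht.2.1, by
        by_contra! h
        exact absurd ht.1 (not_lt.2 (leftLim_le_upperQuantile hr0 h ht.2.2))⟩
    _ = ENNReal.ofReal r := by simp

lemma le_measureReal_Iic_leftLim {r : ℝ} (hr1 : r < 1) :
    r ≤ μ.real (Iic (Function.leftLim (upperQuantile μ id) r)) := by
  refine (ENNReal.ofReal_le_iff_le_toReal (measure_ne_top _ _)).1 ?_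
  set q := Function.leftLim (upperQuantile μ id) r with hq
  nth_rw 1 [← map_upperQuantile (μ := μ)]
  rw [Measure.map_apply_of_aemeasurable aemeasurable_upperQuantile measurableSet_Iic,
    Measure.restrict_apply' measurableSet_Ioo]
  calc ENNReal.ofReal r = volume (Ioo 0 r) := by simp
    _ ≤ volume (upperQuantile μ id ⁻¹' Iic q ∩ Ioo 0 1) := measure_mono fun t ht =>
        ⟨upperQuantile_le_leftLim hr1 ht, ht.1, ht.2.trans hr1⟩

lemma integrableOn_upperQuantile (h : Integrable id μ) :
    IntegrableOn (upperQuantile μ id) (Ioo 0 1) := by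
  rw [← map_upperQuantile (μ := μ)] at h
  exact (integrable_map_measure aestronglyMeasurable_id aemeasurable_upperQuantile).1 h

lemma integral_comp_upperQuantile {f : ℝ → ℝ} (hf : Continuous f) :
    ∫ t in Ioo (0 : ℝ) 1, f (upperQuantile μ id t) = ∫ y, f y ∂μ := by
  conv_rhs => rw [← map_upperQuantile (μ := μ)]
  rw [integral_map aemeasurable_upperQuantile hf.aestronglyMeasurable]

/-- The quantile is at most `q` before `r` and at least `q` from `r` on, so `(q - Q)⁺` is `q - Q`
cut off at `r`. This formula stays valid when the law has an atom at `q`. -/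
lemma integral_upperQuantile_left {r : ℝ} (hr0 : 0 < r) (hr1 : r < 1) (h : Integrable id μ) :
    ∫ t in (0 : ℝ)..r, upperQuantile μ id t =
      r * Function.leftLim (upperQuantile μ id) r
        - ∫ y, max (Function.leftLim (upperQuantile μ id) r - y) 0 ∂μ := by
  set q := Function.leftLim (upperQuantile μ id) r with hq
  have hi := integrableOn_upperQuantile h
  have e1 : ∫ t in Ioo (0 : ℝ) 1, max (q - upperQuantile μ id t) 0
      = ∫ t in Ioo (0 : ℝ) r, (q - upperQuantile μ id t) := by
    rw [← integral_indicator measurableSet_Ioo, ← integral_indicator measurableSet_Ioo]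
    congr 1
    funext t
    simp only [indicator]
    by_cases h0 : 0 < t
    · rcases lt_or_ge t r with h1 | h1
      · have := upperQuantile_le_leftLim (μ := μ) hr1 ⟨h0, h1⟩
        simp [h0, h1, h1.trans hr1, hq, this]
      · by_cases h2 : t < 1
        · have := leftLim_le_upperQuantile (μ := μ) hr0 h1 h2
          simp [h1.not_gt, hq, this]
        · simp [h2, h1.not_gt]
    · simp [h0]
  rw [integral_comp_upperQuantile (f := fun y => max (q - y) 0) (by fun_prop)] at e1
  rw [e1, integral_sub (integrable_const q) (hi.mono_set (Ioo_subset_Ioo_right hr1.le)),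
    intervalIntegral.integral_of_le hr0.le, integral_Ioc_eq_integral_Ioo]
  simp [hr0.le]

lemma integral_upperQuantile_add {r : ℝ} (hr0 : 0 < r) (hr1 : r < 1) (h : Integrable id μ) :
    (∫ t in (0 : ℝ)..r, upperQuantile μ id t) + ∫ t in r..1, upperQuantile μ id t
      = ∫ y, y ∂μ := by
  have hi := (integrableOn_Ioc_iff_integrableOn_Ioo).2 (integrableOn_upperQuantile h)
  rw [intervalIntegral.integral_add_adjacent_intervals,
    intervalIntegral.integral_of_le zero_le_one, integral_Ioc_eq_integral_Ioo]
  · exact integral_comp_upperQuantile (f := fun y => y) continuous_id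
  · exact (intervalIntegrable_iff_integrableOn_Ioc_of_le hr0.le).2
      (hi.mono_set (Ioc_subset_Ioc_right hr1.le))
  · exact (intervalIntegrable_iff_integrableOn_Ioc_of_le hr1.le).2
      (hi.mono_set (Ioc_subset_Ioc_left hr0.le))

end Quantile

/-! ### Transfer of the quantile formulas to random variables. -/

section TailExpectation

variable {Ω : Type*} [MeasurableSpace Ω] {P : Measure Ω} [IsProbabilityMeasure P] {X : Ω → ℝ}
  {r : ℝ}

lemma measureReal_lt_leftLim_upperQuantile_le (hX : AEMeasurable X P) (hr0 : 0 < r) :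
    P.real {ω | X ω < Function.leftLim (upperQuantile P X) r} ≤ r := by
  have := Measure.isProbabilityMeasure_map hX
  rw [upperQuantile_eq_map hX]
  refine le_trans (le_of_eq ?_) (measureReal_Iio_leftLim_le (μ := P.map X) hr0)
  rw [Measure.real, Measure.real, Measure.map_apply_of_aemeasurable hX measurableSet_Iio]
  rfl

lemma le_measureReal_le_leftLim_upperQuantile (hX : AEMeasurable X P) (hr1 : r < 1) :
    r ≤ P.real {ω | X ω ≤ Function.leftLim (upperQuantile P X) r} := by
  have := Measure.isProbabilityMeasure_map hX
  rw [upperQuantile_eq_map hX]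
  refine (le_measureReal_Iic_leftLim (μ := P.map X) hr1).trans (le_of_eq ?_)
  rw [Measure.real, Measure.real, Measure.map_apply_of_aemeasurable hX measurableSet_Iic]
  rfl

lemma integral_upperQuantile_lower (hX : Integrable X P) (hr0 : 0 < r) (hr1 : r < 1) :
    ∫ t in (0 : ℝ)..r, upperQuantile P X t =
      r * Function.leftLim (upperQuantile P X) r
        - ∫ ω, max (Function.leftLim (upperQuantile P X) r - X ω) 0 ∂P := by
  have hm := hX.aemeasurable
  have := Measure.isProbabilityMeasure_map hm
  rw [upperQuantile_eq_map hm, integral_upperQuantile_left hr0 hr1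
    ((integrable_map_measure aestronglyMeasurable_id hm).2 hX),
    integral_map hm (by fun_prop)]

lemma integral_upperQuantile_upper (hX : Integrable X P) (hr0 : 0 < r) (hr1 : r < 1) :
    ∫ t in r..1, upperQuantile P X t =
      ∫ ω, X ω ∂P - ∫ t in (0 : ℝ)..r, upperQuantile P X t := by
  have hm := hX.aemeasurable
  have := Measure.isProbabilityMeasure_map hm
  have h := integral_upperQuantile_add hr0 hr1
    ((integrable_map_measure aestronglyMeasurable_id hm).2 hX)
  rw [integral_map hm (by fun_prop)] at h
  rw [upperQuantile_eq_map hm]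
  linarith

end TailExpectation

/-! ### Increasing convex domination of a two-point law. -/

section Order

open Set

/-- A convex function on `ℝ` lies above its tangent with the right derivative as slope. -/
lemma ConvexOn.rightDeriv_tangent_le {f : ℝ → ℝ} (hf : ConvexOn ℝ univ f) (z y : ℝ) :
    f z + derivWithin f (Ioi z) z * (y - z) ≤ f y := by
  have hz : z ∈ interior (univ : Set ℝ) := by simp
  rcases lt_trichotomy y z with h | rfl | h
  · have h1 := (hf.slope_le_leftDeriv_of_mem_interior (mem_univ y) hz h).trans
      (hf.leftDeriv_le_rightDeriv_of_mem_interior hz)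
    rw [slope_def_field, div_le_iff₀ (by linarith)] at h1
    linarith
  · simp
  · have h1 := hf.rightDeriv_le_slope_of_mem_interior hz (mem_univ y) h
    rw [slope_def_field, le_div_iff₀ (by linarith)] at h1
    linarith

variable {Ω : Type*} [MeasurableSpace Ω] {P : Measure Ω} {X X₀ φ : Ω → ℝ} {a b p : ℝ}

lemma integral_comp_two_point (hp0 : 0 < p) (hp1 : p < 1) (hX₀ : AEMeasurable X₀ P)
    (hlaw : P.map X₀ =
      ENNReal.ofReal p • Measure.dirac a + ENNReal.ofReal (1 - p) • Measure.dirac b)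
    {f : ℝ → ℝ} (hf : Continuous f) :
    Integrable (fun ω => f (X₀ ω)) P ∧ ∫ ω, f (X₀ ω) ∂P = p * f a + (1 - p) * f b := by
  have hi : ∀ (s c : ℝ), Integrable f (ENNReal.ofReal s • Measure.dirac c) := fun s c =>
    (integrable_dirac (by simp)).smul_measure (by simp)
  constructor
  · refine (integrable_map_measure hf.aestronglyMeasurable hX₀).1 ?_
    rw [hlaw]
    exact (hi _ _).add_measure (hi _ _)
  · rw [← integral_map hX₀ hf.aestronglyMeasurable, hlaw, integral_add_measure (hi _ _) (hi _ _)]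
    simp [hp0.le, hp1.le]

lemma IcxDominates.le_integral (h : IcxDominates P X X₀) (hp0 : 0 < p) (hp1 : p < 1)
    (hX₀ : AEMeasurable X₀ P)
    (hlaw : P.map X₀ =
      ENNReal.ofReal p • Measure.dirac a + ENNReal.ofReal (1 - p) • Measure.dirac b)
    (hX : Integrable X P) : p * a + (1 - p) * b ≤ ∫ ω, X ω ∂P := by
  obtain ⟨h1, h2⟩ := integral_comp_two_point hp0 hp1 hX₀ hlaw continuous_id
  exact h2.ge.trans (h id monotone_id (convexOn_id convex_univ) hX h1)

lemma integrable_weight_mul (hφm : AEMeasurable φ P) (hφ0 : ∀ ω, 0 ≤ φ ω) (hφ1 : ∀ ω, φ ω ≤ 1)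
    (hX : Integrable X P) : Integrable (fun ω => φ ω * X ω) P :=
  hX.bdd_mul hφm.aestronglyMeasurable (c := 1)
    (ae_of_all _ fun ω => by rw [Real.norm_eq_abs, abs_of_nonneg (hφ0 ω)]; exact hφ1 ω)

variable [IsProbabilityMeasure P]

/-- A payoff with large enough mean, and large enough weighted mean for some weight of total mass
`1 - p`, dominates the two-point benchmark in the increasing convex order. -/
lemma icxDominates_of_weight (hab : a ≤ b) (hp0 : 0 < p) (hp1 : p < 1) (hX₀ : AEMeasurable X₀ P)
    (hlaw : P.map X₀ =
      ENNReal.ofReal p • Measure.dirac a + ENNReal.ofReal (1 - p) • Measure.dirac b)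
    (hX : Integrable X P) (hφm : AEMeasurable φ P) (hφ0 : ∀ ω, 0 ≤ φ ω) (hφ1 : ∀ ω, φ ω ≤ 1)
    (hφ : ∫ ω, φ ω ∂P = 1 - p) (htop : (1 - p) * b ≤ ∫ ω, φ ω * X ω ∂P)
    (hmean : p * a + (1 - p) * b ≤ ∫ ω, X ω ∂P) : IcxDominates P X X₀ := by
  intro f hmono hconv hfX _
  have hcont : Continuous f := continuousOn_univ.1 (hconv.continuousOn isOpen_univ)
  rw [(integral_comp_two_point hp0 hp1 hX₀ hlaw hcont).2]
  set s : ℝ → ℝ := fun z => derivWithin f (Ioi z) z with hs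
  have hsa : 0 ≤ s a := by
    have h1 := hconv.rightDeriv_tangent_le a (a - 1)
    have h2 := hmono (show a - 1 ≤ a by linarith)
    simp only [hs]
    linarith
  have hsab : s a ≤ s b := by
    have h := hconv.monotoneOn_rightDeriv
    rw [interior_univ] at h
    exact h (mem_univ a) (mem_univ b) hab
  have hφi : Integrable φ P := by
    simpa using integrable_weight_mul hφm hφ0 hφ1 (integrable_const (1 : ℝ))
  have hφX := integrable_weight_mul hφm hφ0 hφ1 hX
  -- The average of the tangents at `b` and `a` with weights `φ` and `1 - φ`. Its integral is `p
  -- f(a) + (1-p) f(b)` plus `s a` times the mean excess plus `s b - s a` times the tail excess.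
  have hpt : ∀ ω, f a - s a * a + s a * X ω + (f b - s b * b - f a + s a * a) * φ ω
      + (s b - s a) * (φ ω * X ω) ≤ f (X ω) := fun ω => by
    have h1 := mul_le_mul_of_nonneg_left (hconv.rightDeriv_tangent_le b (X ω)) (hφ0 ω)
    have h2 := mul_le_mul_of_nonneg_left (hconv.rightDeriv_tangent_le a (X ω))
      (sub_nonneg.2 (hφ1 ω))
    simp only [hs]
    linarith
  have hle := integral_mono (by fun_prop) hfX hpt
  rw [integral_add (by fun_prop) (by fun_prop), integral_add (by fun_prop) (by fun_prop),
    integral_add (by fun_prop) (by fun_prop)] at hle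
  simp only [integral_const_mul, integral_const, probReal_univ, one_smul, hφ] at hle
  nlinarith [mul_le_mul_of_nonneg_left htop (sub_nonneg.2 hsab),
    mul_le_mul_of_nonneg_left hmean hsa]

/-- The call payoff `(y - c)⁺` is increasing and convex; on the benchmark, the part at `a` is
dropped and the part at `b` is bounded by `b - c`. -/
lemma IcxDominates.le_integral_max (h : IcxDominates P X X₀) (hp0 : 0 < p) (hp1 : p < 1)
    (hX₀ : AEMeasurable X₀ P)
    (hlaw : P.map X₀ =
      ENNReal.ofReal p • Measure.dirac a + ENNReal.ofReal (1 - p) • Measure.dirac b)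
    (hX : Integrable X P) (c : ℝ) : (1 - p) * (b - c) ≤ ∫ ω, max (X ω - c) 0 ∂P := by
  obtain ⟨h1, h2⟩ := integral_comp_two_point (f := fun y => max (y - c) 0) hp0 hp1 hX₀ hlaw
    (by fun_prop)
  have h3 := h (fun y => max (y - c) 0)
    (fun y z hyz => max_le_max_right 0 (sub_le_sub_right hyz c))
    (((convexOn_id convex_univ).sub (concaveOn_const c convex_univ)).sup
      (convexOn_const 0 convex_univ)) (hX.sub (integrable_const c)).pos_part h1
  rw [h2] at h3
  refine le_trans ?_ h3
  nlinarith [mul_nonneg hp0.le (le_max_right (a - c) 0),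
    mul_le_mul_of_nonneg_left (le_max_left (b - c) 0) (sub_nonneg.2 hp1.le)]

end Order

/-! ### Tail weights, replacing quantile integrals by expectations. -/

section Tail

variable {Ω : Type*} [MeasurableSpace Ω] {P : Measure Ω} {X : Ω → ℝ}
  {p q r : ℝ} {φ : Ω → ℝ}

/-- `φ` is a weight of total mass `r` that sits on the lowest values of `X`, up to the level `q`. -/
structure IsLowerTailWeight (P : Measure Ω) (X : Ω → ℝ) (r q : ℝ) (φ : Ω → ℝ) : Prop where
  aemeasurable : AEMeasurable φ P
  nonneg : ∀ ω, 0 ≤ φ ω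
  le_one : ∀ ω, φ ω ≤ 1
  integral_eq : ∫ ω, φ ω ∂P = r
  mul_sub_eq : ∀ ω, φ ω * (q - X ω) = max (q - X ω) 0

lemma aemeasurable_ite_comp {s : Set ℝ} [DecidablePred (· ∈ s)] (hs : MeasurableSet s)
    (hX : AEMeasurable X P) : AEMeasurable (fun ω => if X ω ∈ s then (1 : ℝ) else 0) P :=
  (Measurable.ite hs measurable_const measurable_const :
    Measurable fun y : ℝ => if y ∈ s then (1 : ℝ) else 0).comp_aemeasurable hX

lemma integral_ite_comp {s : Set ℝ} [DecidablePred (· ∈ s)] (hs : MeasurableSet s)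
    (hX : AEMeasurable X P) :
    ∫ ω, (if X ω ∈ s then (1 : ℝ) else 0) ∂P = P.real {ω | X ω ∈ s} := by
  have h : (fun ω => if X ω ∈ s then (1 : ℝ) else 0) = (X ⁻¹' s).indicator 1 := by
    funext ω
    simp [Set.indicator]
  rw [h, integral_indicator₀ (hX.nullMeasurableSet_preimage hs)]
  simp
  rfl

lemma isLowerTailWeight_indicator (hX : AEMeasurable X P)
    (hq : P.real {ω | X ω ≤ q} = 1 - p) :
    IsLowerTailWeight P X (1 - p) q fun ω => if X ω ≤ q then 1 else 0 where
  aemeasurable := aemeasurable_ite_comp measurableSet_Iic hX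
  nonneg ω := by split_ifs <;> norm_num
  le_one ω := by split_ifs <;> norm_num
  integral_eq := (integral_ite_comp measurableSet_Iic hX).trans hq
  mul_sub_eq ω := by
    split_ifs with h
    · simp [h]
    · simp [(not_le.1 h).le]

lemma IsLowerTailWeight.integrable_mul (h : IsLowerTailWeight P X r q φ) {Y : Ω → ℝ}
    (hY : Integrable Y P) : Integrable (fun ω => φ ω * Y ω) P :=
  integrable_weight_mul h.aemeasurable h.nonneg h.le_one hY

variable [IsProbabilityMeasure P]

/-- An atom at `q` may prevent any event `X ≤ y` from having mass `r`; a convex combination of the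
indicators of `X < q` and `X ≤ q` then has the right mass. -/
lemma exists_isLowerTailWeight (hX : AEMeasurable X P)
    (h1 : P.real {ω | X ω < q} ≤ r) (h2 : r ≤ P.real {ω | X ω ≤ q}) :
    ∃ φ, IsLowerTailWeight P X r q φ := by
  obtain ⟨s, t, hs, ht, hst, hr⟩ := (Convex.mem_Icc (h1.trans h2)).1 ⟨h1, h2⟩
  have m1 := aemeasurable_ite_comp (P := P) (s := Set.Iio q) measurableSet_Iio hX
  have m2 := aemeasurable_ite_comp (P := P) (s := Set.Iic q) measurableSet_Iic hX
  have hb : ∀ (u : Set ℝ) [DecidablePred (· ∈ u)],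
      AEMeasurable (fun ω => if X ω ∈ u then (1 : ℝ) else 0) P →
      Integrable (fun ω => if X ω ∈ u then (1 : ℝ) else 0) P := fun u _ hu =>
    (integrable_const (1 : ℝ)).mono' hu.aestronglyMeasurable
      (ae_of_all _ fun ω => by split_ifs <;> simp)
  refine ⟨fun ω => s * (if X ω ∈ Set.Iio q then 1 else 0)
    + t * (if X ω ∈ Set.Iic q then 1 else 0), (m1.const_mul s).add (m2.const_mul t),
    fun ω => ?_, fun ω => ?_, ?_, fun ω => ?_⟩
  · positivity
  · split_ifs <;> linarith
  · rw [integral_add ((hb _ m1).const_mul s) ((hb _ m2).const_mul t), integral_const_mul,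
      integral_const_mul, integral_ite_comp measurableSet_Iio hX,
      integral_ite_comp measurableSet_Iic hX]
    exact hr
  · simp only [Set.mem_Iio, Set.mem_Iic]
    rcases lt_trichotomy (X ω) q with h | h | h
    · rw [if_pos h, if_pos h.le, max_eq_left (by linarith)]
      linear_combination (q - X ω) * hst
    · simp [h]
    · rw [if_neg h.not_gt, if_neg h.not_ge, max_eq_right (by linarith)]
      ring

lemma IsLowerTailWeight.integrable (h : IsLowerTailWeight P X r q φ) : Integrable φ P := by
  simpa using integrable_weight_mul h.aemeasurable h.nonneg h.le_one (integrable_const (1 : ℝ))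

lemma IsLowerTailWeight.integral_mul_eq (h : IsLowerTailWeight P X r q φ) (hX : Integrable X P) :
    ∫ ω, φ ω * X ω ∂P = r * q - ∫ ω, max (q - X ω) 0 ∂P := by
  have h1 : ∫ ω, max (q - X ω) 0 ∂P = ∫ ω, (q * φ ω - φ ω * X ω) ∂P :=
    integral_congr_ae (ae_of_all _ fun ω => by
      simp only [← h.mul_sub_eq ω]
      ring)
  rw [h1, integral_sub (h.integrable.const_mul q) (h.integrable_mul hX), integral_const_mul,
    h.integral_eq]
  ring

/-- The lower and upper tail means of a nonconstant variable are strictly ordered. -/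
lemma IsLowerTailWeight.integral_mul_lt (h : IsLowerTailWeight P X r q φ) (hr0 : 0 < r)
    (hr1 : r < 1) (hX : Integrable X P) (hne : ¬ X =ᵐ[P] fun _ => q) :
    ∫ ω, φ ω * X ω ∂P < r * ∫ ω, X ω ∂P := by
  have hd : ∀ ω, 0 ≤ (X ω - q) * (1 - φ ω) := fun ω => by
    have := le_max_left (q - X ω) 0
    rw [← h.mul_sub_eq] at this
    linarith
  have hu : ∀ ω, 0 ≤ φ ω * (q - X ω) := fun ω => by
    rw [h.mul_sub_eq]
    exact le_max_right _ _
  have hi := h.integrable_mul hX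
  have hφ := h.integrable
  -- The integral of `H` is the gap to be proved positive, and `H` is a positive combination of two
  -- nonnegative terms that vanish together only where `X = q`.
  set H : Ω → ℝ := fun ω => r * (X ω - q) + q * φ ω - φ ω * X ω with hH
  have hHeq : ∀ ω, H ω = r * ((X ω - q) * (1 - φ ω)) + (1 - r) * (φ ω * (q - X ω)) := fun ω => by
    simp only [hH]
    ring
  have hH0 : ∀ ω, 0 ≤ H ω := fun ω => by
    rw [hHeq]
    exact add_nonneg (mul_nonneg hr0.le (hd ω)) (mul_nonneg (by linarith) (hu ω))
  have hHi : Integrable H P := by fun_prop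
  have hHint : ∫ ω, H ω ∂P = r * ∫ ω, X ω ∂P - ∫ ω, φ ω * X ω ∂P := by
    simp only [hH]
    rw [integral_sub (by fun_prop) hi, integral_add (by fun_prop) (by fun_prop),
      integral_const_mul, integral_const_mul, integral_sub hX (integrable_const q), h.integral_eq]
    simp
    ring
  by_contra! hle
  have hz : ∫ ω, H ω ∂P = 0 := le_antisymm (by linarith) (integral_nonneg hH0)
  apply hne
  filter_upwards [(integral_eq_zero_iff_of_nonneg hH0 hHi).1 hz] with ω hω
  simp only [Pi.zero_apply] at hω
  rw [hHeq] at hω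
  have e1 : (X ω - q) * (1 - φ ω) = 0 := by nlinarith [hd ω, hu ω]
  have e2 : φ ω * (q - X ω) = 0 := by nlinarith [hd ω, hu ω]
  linarith

end Tail

/-! ### Variance minimality from uniqueness. -/

section Minimal

variable {Ω : Type*} [MeasurableSpace Ω] {P : Measure Ω} {ρ X₀ Z : Ω → ℝ} {x : ℝ}

lemma icxFeasible_congr {X Y : Ω → ℝ} (hXY : X =ᵐ[P] Y) (hY : Y ∈ icxFeasible P ρ x X₀) :
    X ∈ icxFeasible P ρ x X₀ := by
  obtain ⟨h1, h2, h3⟩ := hY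
  refine ⟨h1.ae_eq hXY.symm, ?_, fun f hf hc hi hi₀ => ?_⟩
  · rwa [integral_congr_ae (g := fun ω => ρ ω * Y ω)
      (by filter_upwards [hXY] with ω hω; rw [hω])]
  · have e : (fun ω => f (X ω)) =ᵐ[P] fun ω => f (Y ω) := hXY.fun_comp f
    rw [integral_congr_ae e]
    exact h3 f hf hc (hi.congr e) hi₀

/-- A feasible payoff that is a.s. the only one with variance at most its own is the a.s. unique
variance-minimal payoff. -/
lemma isVarianceMinimal_iff_ae_eq (hZ : Z ∈ icxFeasible P ρ x X₀)
    (h : ∀ Y ∈ icxFeasible P ρ x X₀, Var[Y; P] ≤ Var[Z; P] → Y =ᵐ[P] Z) (X : Ω → ℝ) :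
    IsVarianceMinimal P ρ x X₀ X ↔ X =ᵐ[P] Z := by
  refine ⟨fun hX => h X hX.1 (hX.2 Z hZ), fun hX => ⟨icxFeasible_congr hX hZ, fun Y hY => ?_⟩⟩
  rw [variance_congr hX]
  by_contra! hlt
  exact hlt.ne (variance_congr (h Y hY hlt.le))

end Minimal

/-! ### Pointwise minimization of the Lagrangian. -/

section Lagrangian

/-- The payoff `μ - k ρ`, raised by `d` on the event `ρ ≤ q`. -/
noncomputable def raisedPayoff (μ k d q r : ℝ) : ℝ := if q < r then μ - k * r else μ + d - k * r

/-- The integrand of the Lagrangian of the variance minimization problem. -/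
noncomputable def lagrangian (μ k d q r y : ℝ) : ℝ :=
  y ^ 2 + 2 * k * (r * y) - 2 * μ * y - 2 * d * max (y - (μ - k * q + d / 2)) 0

/-- In `y` the Lagrangian is the lower envelope of two parabolas with vertices `μ - k r` and `μ + d
- k r`. The strike `μ - k q + d / 2` is the one for which the two minima tie exactly at `r = q`; for
larger `r` the lower vertex wins, for smaller `r` the upper one. -/
lemma lagrangian_raisedPayoff_le {μ k d q r y : ℝ} (hk : 0 ≤ k) (hd : 0 ≤ d) :
    lagrangian μ k d q r (raisedPayoff μ k d q r) ≤ lagrangian μ k d q r y := by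
  have hdk := mul_nonneg hd hk
  simp only [lagrangian, raisedPayoff]
  split_ifs with h
  · have h' := mul_nonneg hk (sub_nonneg.2 h.le)
    rw [max_eq_right (by linarith)]
    rcases max_cases (y - (μ - k * q + d / 2)) 0 with ⟨e, -⟩ | ⟨e, -⟩ <;> rw [e]
    · nlinarith [sq_nonneg (y - (μ - k * r) - d), mul_nonneg hdk (sub_nonneg.2 h.le)]
    · nlinarith [sq_nonneg (y - (μ - k * r))]
  · push Not at h
    have h' := mul_nonneg hk (sub_nonneg.2 h)
    rw [max_eq_left (by linarith)]
    rcases max_cases (y - (μ - k * q + d / 2)) 0 with ⟨e, -⟩ | ⟨e, -⟩ <;> rw [e]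
    · nlinarith [sq_nonneg (y - (μ + d - k * r))]
    · nlinarith [sq_nonneg (y - (μ - k * r)), mul_nonneg hdk (sub_nonneg.2 h)]

/-- Only an inequality can hold: at the tie `r = q` both vertices are minimizers, and the raised
payoff takes the larger. For `r > q` a tie is excluded by `k > 0`, unless `d = 0` and the vertices
coincide. -/
lemma le_raisedPayoff_of_lagrangian_eq {μ k d q r y : ℝ} (hk : 0 ≤ k) (hd : 0 ≤ d)
    (hkd : d = 0 ∨ 0 < k)
    (h : lagrangian μ k d q r y = lagrangian μ k d q r (raisedPayoff μ k d q r)) :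
    y ≤ raisedPayoff μ k d q r := by
  simp only [lagrangian, raisedPayoff] at h ⊢
  split_ifs at h ⊢ with hr
  · have h' := mul_nonneg hk (sub_nonneg.2 hr.le)
    rw [max_eq_right (a := μ - k * r - (μ - k * q + d / 2)) (by linarith)] at h
    rcases max_cases (y - (μ - k * q + d / 2)) 0 with ⟨e, hy⟩ | ⟨e, hy⟩ <;> rw [e] at h
    · have h1 : (y - (μ - k * r) - d) ^ 2 + 2 * d * (k * (r - q)) = 0 := by linarith
      have h2 := mul_nonneg hd h'
      have h3 : y - (μ - k * r) - d = 0 := by nlinarith [sq_nonneg (y - (μ - k * r) - d)]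
      have h4 : d * (k * (r - q)) = 0 := by nlinarith [sq_nonneg (y - (μ - k * r) - d)]
      have h5 : d = 0 := by
        rcases hkd with h5 | h5
        · exact h5
        · exact (mul_eq_zero.1 h4).resolve_right (mul_pos h5 (sub_pos.2 hr)).ne'
      linarith
    · have h1 : (y - (μ - k * r)) ^ 2 = 0 := by linarith
      have h2 := pow_eq_zero_iff (two_ne_zero) |>.1 h1
      linarith
  · push Not at hr
    have h' := mul_nonneg hk (sub_nonneg.2 hr)
    rw [max_eq_left (a := μ + d - k * r - (μ - k * q + d / 2)) (by linarith)] at h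
    rcases max_cases (y - (μ - k * q + d / 2)) 0 with ⟨e, hy⟩ | ⟨e, hy⟩ <;> rw [e] at h
    · have h1 : (y - (μ + d - k * r)) ^ 2 = 0 := by linarith
      have h2 := pow_eq_zero_iff (two_ne_zero) |>.1 h1
      linarith
    · have h1 : (y - (μ - k * r)) ^ 2 + 2 * d * (k * (q - r)) = 0 := by linarith
      have h2 := mul_nonneg hd h'
      have h3 : y - (μ - k * r) = 0 := by nlinarith [sq_nonneg (y - (μ - k * r))]
      linarith

variable {Ω : Type*} [MeasurableSpace Ω] {P : Measure Ω} {ρ T Y : Ω → ℝ}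
  {μ k d q : ℝ}

lemma raisedPayoff_eq_indicator (μ k d q r : ℝ) :
    raisedPayoff μ k d q r = μ + d * (if r ≤ q then 1 else 0) - k * r := by
  rw [raisedPayoff]
  rcases le_or_gt r q with h | h
  · simp [h, h.not_gt]
  · simp [h, h.not_ge]

variable [IsProbabilityMeasure P]

lemma memLp_raisedPayoff (hρ : MemLp ρ 2 P) :
    MemLp (fun ω => raisedPayoff μ k d q (ρ ω)) 2 P := by
  simp only [raisedPayoff_eq_indicator]
  have hm : AEStronglyMeasurable (fun ω => if ρ ω ≤ q then (1 : ℝ) else 0) P :=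
    (aemeasurable_ite_comp (s := Set.Iic q) measurableSet_Iic
      hρ.1.aemeasurable).aestronglyMeasurable
  have h1 : MemLp (fun ω => if ρ ω ≤ q then (1 : ℝ) else 0) 2 P :=
    MemLp.of_bound hm 1 (ae_of_all _ fun ω => by split_ifs <;> simp)
  exact ((memLp_const μ).add (h1.const_mul d)).sub (hρ.const_mul k)

lemma integrable_lagrangian (hρ : MemLp ρ 2 P) (hT : MemLp T 2 P) :
    Integrable (fun ω => lagrangian μ k d q (ρ ω) (T ω)) P := by
  have h1 := hT.integrable one_le_two
  have h2 := hT.integrable_sq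
  have h3 := hρ.integrable_mul hT
  have h4 := (h1.sub (integrable_const (μ - k * q + d / 2))).pos_part
  exact ((h2.add (h3.const_mul (2 * k))).sub (h1.const_mul (2 * μ))).sub (h4.const_mul (2 * d))

lemma integral_lagrangian (hρ : MemLp ρ 2 P) (hT : MemLp T 2 P) :
    ∫ ω, lagrangian μ k d q (ρ ω) (T ω) ∂P = ∫ ω, T ω ^ 2 ∂P + 2 * k * ∫ ω, ρ ω * T ω ∂P
      - 2 * μ * ∫ ω, T ω ∂P - 2 * d * ∫ ω, max (T ω - (μ - k * q + d / 2)) 0 ∂P := by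
  have h1 := hT.integrable one_le_two
  have h2 := hT.integrable_sq
  have h3 : Integrable (fun ω => ρ ω * T ω) P := hρ.integrable_mul hT
  have h4 : Integrable (fun ω => max (T ω - (μ - k * q + d / 2)) 0) P :=
    (h1.sub (integrable_const (μ - k * q + d / 2))).pos_part
  simp only [lagrangian]
  rw [integral_sub (by fun_prop) (by fun_prop), integral_sub (by fun_prop) (by fun_prop),
    integral_add (by fun_prop) (by fun_prop)]
  simp only [integral_const_mul]

/-- Among the payoffs with the same mean, the raised payoff is the unique minimizer of the second
moment, as long as the penalty for violated constraints is of the right sign. -/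
lemma ae_eq_raisedPayoff_of_sq_le (hρ : MemLp ρ 2 P) (hT : MemLp T 2 P) (hk : 0 ≤ k) (hd : 0 ≤ d)
    (hkd : d = 0 ∨ 0 < k)
    (hmean : ∫ ω, T ω ∂P = ∫ ω, raisedPayoff μ k d q (ρ ω) ∂P)
    (hpen : k * (∫ ω, ρ ω * T ω ∂P - ∫ ω, ρ ω * raisedPayoff μ k d q (ρ ω) ∂P) ≤
      d * (∫ ω, max (T ω - (μ - k * q + d / 2)) 0 ∂P
        - ∫ ω, max (raisedPayoff μ k d q (ρ ω) - (μ - k * q + d / 2)) 0 ∂P))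
    (hsq : ∫ ω, T ω ^ 2 ∂P ≤ ∫ ω, raisedPayoff μ k d q (ρ ω) ^ 2 ∂P) :
    T =ᵐ[P] fun ω => raisedPayoff μ k d q (ρ ω) := by
  have hZ := memLp_raisedPayoff (μ := μ) (k := k) (d := d) (q := q) hρ
  have hiT := integrable_lagrangian (μ := μ) (k := k) (d := d) (q := q) hρ hT
  have hiZ := integrable_lagrangian (μ := μ) (k := k) (d := d) (q := q) hρ hZ
  have hle : ∀ ω, lagrangian μ k d q (ρ ω) (raisedPayoff μ k d q (ρ ω)) ≤
      lagrangian μ k d q (ρ ω) (T ω) := fun ω => lagrangian_raisedPayoff_le hk hd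
  have heq : ∫ ω, lagrangian μ k d q (ρ ω) (raisedPayoff μ k d q (ρ ω)) ∂P =
      ∫ ω, lagrangian μ k d q (ρ ω) (T ω) ∂P := by
    refine le_antisymm (integral_mono hiZ hiT hle) ?_
    rw [integral_lagrangian hρ hT, integral_lagrangian hρ hZ, hmean]
    linarith
  have hTZ : T ≤ᵐ[P] fun ω => raisedPayoff μ k d q (ρ ω) := by
    filter_upwards [(integral_eq_iff_of_ae_le hiZ hiT (ae_of_all _ hle)).1 heq] with ω hω
    exact le_raisedPayoff_of_lagrangian_eq hk hd hkd hω.symm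
  -- Ordered functions with equal means agree a.s., which settles the possible ties on `ρ = q`.
  exact (integral_eq_iff_of_ae_le (hT.integrable one_le_two) (hZ.integrable one_le_two) hTZ).1 hmean

/-- Translating `Y` by the mean difference `δ` keeps its variance, lowers its cost by `δ E[ρ]` and
moves the strike by `δ`; `hpen` is what remains of the penalty condition. Once `Y` is the candidate
plus `δ`, the budget gives `δ ≤ 0`. -/
lemma ae_eq_add_of_variance_le (hρ : MemLp ρ 2 P) (hρmean : 0 < ∫ ω, ρ ω ∂P) (hY : MemLp Y 2 P)
    (hk : 0 ≤ k) (hd : 0 ≤ d) (hkd : d = 0 ∨ 0 < k) {δ : ℝ}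
    (hδ : δ = ∫ ω, Y ω ∂P - ∫ ω, raisedPayoff μ k d q (ρ ω) ∂P)
    (hcost : ∫ ω, ρ ω * Y ω ∂P ≤ ∫ ω, ρ ω * raisedPayoff μ k d q (ρ ω) ∂P)
    (hpen : d * (∫ ω, max (raisedPayoff μ k d q (ρ ω) - (μ - k * q + d / 2)) 0 ∂P
        - ∫ ω, max (Y ω - (μ - k * q + d / 2 + δ)) 0 ∂P) ≤ k * (δ * ∫ ω, ρ ω ∂P))
    (hvar : Var[Y; P] ≤ Var[fun ω => raisedPayoff μ k d q (ρ ω); P]) :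
    δ ≤ 0 ∧ Y =ᵐ[P] fun ω => raisedPayoff μ k d q (ρ ω) + δ := by
  have hZ := memLp_raisedPayoff (μ := μ) (k := k) (d := d) (q := q) hρ
  have hT : MemLp (fun ω => Y ω - δ) 2 P := hY.sub (memLp_const δ)
  have hρi := hρ.integrable one_le_two
  have hρY : Integrable (fun ω => ρ ω * Y ω) P := hρ.integrable_mul hY
  have hρZ : Integrable (fun ω => ρ ω * raisedPayoff μ k d q (ρ ω)) P := hρ.integrable_mul hZ
  have hmean : ∫ ω, (Y ω - δ) ∂P = ∫ ω, raisedPayoff μ k d q (ρ ω) ∂P := by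
    rw [integral_sub (hY.integrable one_le_two) (integrable_const δ), hδ]
    simp
  have hcostT : ∫ ω, ρ ω * (Y ω - δ) ∂P = ∫ ω, ρ ω * Y ω ∂P - δ * ∫ ω, ρ ω ∂P := by
    rw [← integral_const_mul, ← integral_sub hρY (by fun_prop)]
    congr 1
    funext ω
    ring
  have hTZ : (fun ω => Y ω - δ) =ᵐ[P] fun ω => raisedPayoff μ k d q (ρ ω) := by
    refine ae_eq_raisedPayoff_of_sq_le hρ hT hk hd hkd hmean ?_ ?_
    · have e : ∀ ω, Y ω - δ - (μ - k * q + d / 2) = Y ω - (μ - k * q + d / 2 + δ) := fun ω => by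
        ring
      simp only [hcostT, e]
      nlinarith [mul_le_mul_of_nonneg_left hcost hk]
    · rw [← variance_sub_const hY.1 δ, variance_eq_sub hT, variance_eq_sub hZ, hmean] at hvar
      exact (sub_le_sub_iff_right _).1 hvar
  have hYZ : Y =ᵐ[P] fun ω => raisedPayoff μ k d q (ρ ω) + δ := by
    filter_upwards [hTZ] with ω hω
    linarith
  refine ⟨?_, hYZ⟩
  have h1 : ∫ ω, ρ ω * (Y ω - δ) ∂P = ∫ ω, ρ ω * raisedPayoff μ k d q (ρ ω) ∂P :=
    integral_congr_ae (by filter_upwards [hTZ] with ω hω; rw [hω])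
  rw [hcostT] at h1
  by_contra! h
  linarith [mul_pos h hρmean]

end Lagrangian

/-! ### Optimality of the linear and the raised payoffs. -/

section TwoPoint

variable {Ω : Type*} [MeasurableSpace Ω] {P : Measure Ω} [IsProbabilityMeasure P]
  {ρ X₀ : Ω → ℝ} {a b p : ℝ}

/-- Linear payoffs: the case in which only the mean constraint binds. -/
lemma isVarianceMinimal_iff_linear (hρ : MemLp ρ 2 P) (hρmean : 0 < ∫ ω, ρ ω ∂P)
    (hab : a ≤ b) (hp0 : 0 < p) (hp1 : p < 1) (hX₀ : AEMeasurable X₀ P)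
    (hlaw : P.map X₀ =
      ENNReal.ofReal p • Measure.dirac a + ENNReal.ofReal (1 - p) • Measure.dirac b)
    {x μ k q A₂ : ℝ} {φ : Ω → ℝ} (hφ : IsLowerTailWeight P ρ (1 - p) q φ)
    (hA₂ : ∫ ω, φ ω * ρ ω ∂P = (1 - p) * A₂) (hk : 0 ≤ k)
    (hmean : μ - k * ∫ ω, ρ ω ∂P = p * a + (1 - p) * b) (htop : b ≤ μ - k * A₂)
    (hcost : μ * ∫ ω, ρ ω ∂P - k * ∫ ω, ρ ω ^ 2 ∂P = x) (X : Ω → ℝ) :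
    IsVarianceMinimal P ρ x X₀ X ↔ X =ᵐ[P] fun ω => μ - k * ρ ω := by
  have hZ : (fun ω => μ - k * ρ ω) = fun ω => raisedPayoff μ k 0 q (ρ ω) := by
    funext ω
    simp [raisedPayoff]
  have hρi := hρ.integrable one_le_two
  have hρ2 := hρ.integrable_sq
  have hL : MemLp (fun ω => μ - k * ρ ω) 2 P := (memLp_const μ).sub (hρ.const_mul k)
  have hLmean : ∫ ω, (μ - k * ρ ω) ∂P = p * a + (1 - p) * b := by
    rw [integral_sub (integrable_const μ) (by fun_prop), integral_const_mul, ← hmean]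
    simp
  have hLcost : ∫ ω, ρ ω * (μ - k * ρ ω) ∂P = x := by
    rw [← hcost, ← integral_const_mul, ← integral_const_mul,
      ← integral_sub (by fun_prop) (by fun_prop)]
    congr 1
    funext ω
    ring
  refine isVarianceMinimal_iff_ae_eq ⟨hL, hLcost.le, ?_⟩ (fun Y hY hvar => ?_) X
  · refine icxDominates_of_weight hab hp0 hp1 hX₀ hlaw (hL.integrable one_le_two)
      hφ.aemeasurable hφ.nonneg hφ.le_one hφ.integral_eq ?_ hLmean.ge
    have hi := hφ.integrable_mul hρi
    have hφi := hφ.integrable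
    have : ∫ ω, φ ω * (μ - k * ρ ω) ∂P = (1 - p) * (μ - k * A₂) := by
      calc _ = ∫ ω, (μ * φ ω - k * (φ ω * ρ ω)) ∂P := by
            congr 1
            funext ω
            ring
        _ = _ := by
            rw [integral_sub (by fun_prop) (by fun_prop), integral_const_mul, integral_const_mul,
              hA₂, hφ.integral_eq]
            ring
    rw [this]
    exact mul_le_mul_of_nonneg_left htop (by linarith)
  · have hYm := hY.2.2.le_integral hp0 hp1 hX₀ hlaw (hY.1.integrable one_le_two)
    have hδ0 : 0 ≤ ∫ ω, Y ω ∂P - ∫ ω, (μ - k * ρ ω) ∂P := by linarith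
    have hc : ∫ ω, ρ ω * Y ω ∂P ≤ ∫ ω, ρ ω * (μ - k * ρ ω) ∂P := hY.2.1.trans hLcost.ge
    rw [hZ] at hvar ⊢
    have hZ' := fun ω => congrFun hZ ω
    simp only [hZ'] at hc hδ0
    obtain ⟨hδ, hYZ⟩ := ae_eq_add_of_variance_le hρ hρmean hY.1 hk le_rfl (Or.inl rfl) rfl hc
      (by rw [zero_mul]; exact mul_nonneg hk (mul_nonneg hδ0 hρmean.le)) hvar
    filter_upwards [hYZ] with ω hω
    rw [hω, le_antisymm hδ hδ0, add_zero]

/-- Raised payoffs: the case in which the constraint on the upper tail binds. -/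
lemma isVarianceMinimal_iff_raised (hρ : MemLp ρ 2 P) (hρmean : 0 < ∫ ω, ρ ω ∂P)
    (hab : a ≤ b) (hp0 : 0 < p) (hp1 : p < 1) (hX₀ : AEMeasurable X₀ P)
    (hlaw : P.map X₀ =
      ENNReal.ofReal p • Measure.dirac a + ENNReal.ofReal (1 - p) • Measure.dirac b)
    {x μ k d q A₂ : ℝ} (hq : P.real {ω | ρ ω ≤ q} = 1 - p)
    (hA₂ : ∫ ω, (if ρ ω ≤ q then 1 else 0) * ρ ω ∂P = (1 - p) * A₂) (hk : 0 < k) (hd : 0 < d)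
    (htop : μ + d - k * A₂ = b)
    (hcost : μ * ∫ ω, ρ ω ∂P - k * ∫ ω, ρ ω ^ 2 ∂P + d * ((1 - p) * A₂) = x)
    (hmean : p * a + (1 - p) * b ≤ μ - k * ∫ ω, ρ ω ∂P + d * (1 - p))
    -- Complementary slackness: `k E[ρ] - d (1-p)` is the multiplier of the mean constraint, so
    -- either it vanishes or it is nonnegative and that constraint binds.
    (hslack : d * (1 - p) = k * ∫ ω, ρ ω ∂P ∨ (d * (1 - p) ≤ k * ∫ ω, ρ ω ∂P ∧
      μ - k * ∫ ω, ρ ω ∂P + d * (1 - p) = p * a + (1 - p) * b)) (X : Ω → ℝ) :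
    IsVarianceMinimal P ρ x X₀ X ↔ X =ᵐ[P] fun ω => raisedPayoff μ k d q (ρ ω) := by
  have hρi := hρ.integrable one_le_two
  have hρ2 := hρ.integrable_sq
  have hι := isLowerTailWeight_indicator hρ.1.aemeasurable hq
  have hιi := hι.integrable
  have hιρ := hι.integrable_mul hρi
  have hιint := hι.integral_eq
  have hZ := memLp_raisedPayoff (μ := μ) (k := k) (d := d) (q := q) hρ
  have hZi := hZ.integrable one_le_two
  have hZmean : ∫ ω, raisedPayoff μ k d q (ρ ω) ∂P = μ - k * ∫ ω, ρ ω ∂P + d * (1 - p) := by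
    simp only [raisedPayoff_eq_indicator]
    rw [integral_sub (by fun_prop) (by fun_prop), integral_add (by fun_prop) (by fun_prop),
      integral_const_mul, integral_const_mul, hιint]
    simp
    ring
  have hZcost : ∫ ω, ρ ω * raisedPayoff μ k d q (ρ ω) ∂P = x := by
    calc _ = ∫ ω, (μ * ρ ω - k * ρ ω ^ 2 + d * ((if ρ ω ≤ q then 1 else 0) * ρ ω)) ∂P := by
          congr 1
          funext ω
          rw [raisedPayoff_eq_indicator]
          ring
      _ = _ := by
          rw [integral_add (by fun_prop) (by fun_prop), integral_sub (by fun_prop) (by fun_prop),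
            integral_const_mul, integral_const_mul, integral_const_mul, hA₂, hcost]
  have hιZ := hι.integrable_mul hZi
  have hZtop : ∫ ω, (if ρ ω ≤ q then 1 else 0) * raisedPayoff μ k d q (ρ ω) ∂P =
      (1 - p) * b := by
    calc _ = ∫ ω, ((μ + d) * (if ρ ω ≤ q then 1 else 0)
            - k * ((if ρ ω ≤ q then 1 else 0) * ρ ω)) ∂P := by
          congr 1
          funext ω
          rw [raisedPayoff_eq_indicator]
          split_ifs <;> ring
      _ = _ := by
          rw [integral_sub (by fun_prop) (by fun_prop), integral_const_mul, integral_const_mul,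
            hA₂, hιint, ← htop]
          ring
  set c := μ - k * q + d / 2 with hc
  have hZpos : ∫ ω, max (raisedPayoff μ k d q (ρ ω) - c) 0 ∂P = (1 - p) * (b - c) := by
    calc _ = ∫ ω, ((if ρ ω ≤ q then 1 else 0) * raisedPayoff μ k d q (ρ ω)
            - c * (if ρ ω ≤ q then 1 else 0)) ∂P := by
          congr 1
          funext ω
          rcases le_or_gt (ρ ω) q with h | h
          · have := mul_nonneg hk.le (sub_nonneg.2 h)
            simp only [raisedPayoff, h.not_gt, h, if_true, if_false]
            rw [max_eq_left (by linarith)]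
            ring
          · have := mul_nonneg hk.le (sub_nonneg.2 h.le)
            simp only [raisedPayoff, h, h.not_ge, if_true, if_false]
            rw [max_eq_right (by linarith)]
            ring
      _ = _ := by
          rw [integral_sub (by fun_prop) (by fun_prop), integral_const_mul, hZtop, hιint]
          ring
  refine isVarianceMinimal_iff_ae_eq ⟨hZ, hZcost.le, ?_⟩ (fun Y hY hvar => ?_) X
  · exact icxDominates_of_weight hab hp0 hp1 hX₀ hlaw hZi hι.aemeasurable hι.nonneg hι.le_one
      hιint hZtop.ge (hmean.trans hZmean.ge)
  · have hYi := hY.1.integrable one_le_two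
    have hYm := hY.2.2.le_integral hp0 hp1 hX₀ hlaw hYi
    obtain ⟨δ, hδ⟩ : ∃ δ, δ = ∫ ω, Y ω ∂P - ∫ ω, raisedPayoff μ k d q (ρ ω) ∂P := ⟨_, rfl⟩
    have hYtop := hY.2.2.le_integral_max hp0 hp1 hX₀ hlaw hYi (c + δ)
    have hpen : d * ((1 - p) * δ) ≤ k * (δ * ∫ ω, ρ ω ∂P) := by
      rcases hslack with h | ⟨h, hm⟩
      · linear_combination δ * h
      · nlinarith [mul_le_mul_of_nonneg_left h (show 0 ≤ δ by linarith)]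
    obtain ⟨hδ0, hYZ⟩ := ae_eq_add_of_variance_le hρ hρmean hY.1 hk.le hd.le (Or.inr hk) hδ
      (hY.2.1.trans hZcost.ge) (by
        rw [← hc, hZpos]
        nlinarith [mul_le_mul_of_nonneg_left hYtop hd.le]) hvar
    -- The mean constraint may be slack, so `δ ≥ 0` is read off the call constraint at strike `c +
    -- δ`, where `Y` has the same call value as the candidate at `c`.
    have hYpos : ∫ ω, max (Y ω - (c + δ)) 0 ∂P = (1 - p) * (b - c) := by
      rw [← hZpos]
      refine integral_congr_ae ?_
      filter_upwards [hYZ] with ω hω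
      rw [hω]
      congr 1
      ring
    have hδ1 : 0 ≤ (1 - p) * δ := by linarith
    have hδ2 : 0 ≤ δ := nonneg_of_mul_nonneg_right hδ1 (by linarith)
    filter_upwards [hYZ] with ω hω
    rw [hω, le_antisymm hδ0 hδ2, add_zero]

end TwoPoint

/-! ### Tail means and the main theorem. -/

section TailMean

variable {Ω : Type*} [MeasurableSpace Ω] {P : Measure Ω} [IsProbabilityMeasure P]
  {X : Ω → ℝ} {p : ℝ}

lemma tailMean_lower (hX : Integrable X P) (hp0 : 0 < p) (hp1 : p < 1) {φ : Ω → ℝ}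
    (hφ : IsLowerTailWeight P X (1 - p) (Function.leftLim (upperQuantile P X) (1 - p)) φ) :
    (1 - p) * (1 / (1 - p) * ∫ s in p..(1 : ℝ), upperQuantile P X (1 - s)) =
      ∫ ω, φ ω * X ω ∂P := by
  have hp : (1 - p) ≠ 0 := (sub_pos.2 hp1).ne'
  rw [intervalIntegral.integral_comp_sub_left (fun t => upperQuantile P X t) 1, sub_self,
    integral_upperQuantile_lower hX (by linarith) (by linarith), hφ.integral_mul_eq hX]
  field_simp

lemma tailMean_upper (hX : Integrable X P) (hp0 : 0 < p) (hp1 : p < 1) {φ : Ω → ℝ}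
    (hφ : IsLowerTailWeight P X (1 - p) (Function.leftLim (upperQuantile P X) (1 - p)) φ) :
    p * (1 / p * ∫ s in (0 : ℝ)..p, upperQuantile P X (1 - s)) =
      ∫ ω, X ω ∂P - ∫ ω, φ ω * X ω ∂P := by
  rw [intervalIntegral.integral_comp_sub_left (fun t => upperQuantile P X t) 1, sub_zero,
    integral_upperQuantile_upper hX (by linarith) (by linarith),
    integral_upperQuantile_lower hX (by linarith) (by linarith), hφ.integral_mul_eq hX]
  field_simp

/-- The second moment is at least the one of the conditional means on `X ≤ q` and its
complement. -/
lemma two_point_sq_le_integral_sq (hX : MemLp X 2 P) {q A₁ A₂ : ℝ}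
    (hq : P.real {ω | X ω ≤ q} = 1 - p)
    (hA₂ : ∫ ω, (if X ω ≤ q then 1 else 0) * X ω ∂P = (1 - p) * A₂)
    (hA₁ : p * A₁ + (1 - p) * A₂ = ∫ ω, X ω ∂P) :
    p * A₁ ^ 2 + (1 - p) * A₂ ^ 2 ≤ ∫ ω, X ω ^ 2 ∂P := by
  have hXi := hX.integrable one_le_two
  have hX2 := hX.integrable_sq
  have hι := isLowerTailWeight_indicator hX.1.aemeasurable hq
  have hιi := hι.integrable
  have hιX := hι.integrable_mul hXi
  have h : 0 ≤ ∫ ω, (X ω ^ 2 + A₁ ^ 2 + (A₂ ^ 2 - A₁ ^ 2) * (if X ω ≤ q then 1 else 0)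
      - 2 * A₁ * X ω - 2 * (A₂ - A₁) * ((if X ω ≤ q then 1 else 0) * X ω)) ∂P := by
    refine integral_nonneg fun ω => ?_
    simp only [Pi.zero_apply]
    split_ifs
    · nlinarith [sq_nonneg (X ω - A₂)]
    · nlinarith [sq_nonneg (X ω - A₁)]
  rw [integral_sub (by fun_prop) (by fun_prop), integral_sub (by fun_prop) (by fun_prop),
    integral_add (by fun_prop) (by fun_prop), integral_add (by fun_prop) (by fun_prop)] at h
  simp only [integral_const_mul, integral_const, probReal_univ, one_smul, hA₂, hι.integral_eq,
    ← hA₁] at h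
  linarith

end TailMean

theorem mainTheorem6 {Ω : Type*} [MeasurableSpace Ω] (P : Measure Ω) [IsProbabilityMeasure P]
    (ρ : Ω → ℝ) (hρ : MemLp ρ 2 P) (hρpos : ∀ᵐ ω ∂P, 0 < ρ ω) (hρvar : 0 < Var[ρ; P])
    (X₀ : Ω → ℝ) (a b p : ℝ) (hab : a ≤ b) (hp0 : 0 < p) (hp1 : p < 1)
    (hX₀ : AEMeasurable X₀ P)
    (hX₀law : P.map X₀ =
      ENNReal.ofReal p • Measure.dirac a + ENNReal.ofReal (1 - p) • Measure.dirac b)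
    (x : ℝ) (A₁ A₂ q : ℝ)
    (hA₁ : A₁ = 1 / p * ∫ s in (0 : ℝ)..p, upperQuantile P ρ (1 - s))
    (hA₂ : A₂ = 1 / (1 - p) * ∫ s in p..(1 : ℝ), upperQuantile P ρ (1 - s))
    (hq : q = Function.leftLim (upperQuantile P ρ) (1 - p)) :
    (x ≤ P[X₀] * P[ρ] - (b - a) / (A₁ - A₂) * Var[ρ; P] →
      ∀ X : Ω → ℝ, IsVarianceMinimal P ρ x X₀ X ↔
        X =ᵐ[P] fun ω => P[X₀] + (P[X₀] * P[ρ] - x) / Var[ρ; P] * P[ρ]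
          - (P[X₀] * P[ρ] - x) / Var[ρ; P] * ρ ω) ∧
    (P.real {ω | ρ ω ≤ q} = 1 - p →
      P[X₀] * P[ρ] - (b - a) / (A₁ - A₂) * Var[ρ; P] < x →
      x ≤ b * P[ρ] - (b - a) / A₁ *
        ((1 - p) * P[fun ω => ρ ω ^ 2] + p ^ 2 * A₁ ^ 2 - (1 - p) ^ 2 * A₂ ^ 2) →
      ∀ X : Ω → ℝ, IsVarianceMinimal P ρ x X₀ X ↔
        X =ᵐ[P] fun ω =>
          if q < ρ ω then
            a + (a * p * A₁ + b * (1 - p) * A₂ - x) /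
                (P[fun ω => ρ ω ^ 2] - p * A₁ ^ 2 - (1 - p) * A₂ ^ 2) * A₁
              - (a * p * A₁ + b * (1 - p) * A₂ - x) /
                (P[fun ω => ρ ω ^ 2] - p * A₁ ^ 2 - (1 - p) * A₂ ^ 2) * ρ ω
          else
            b + (a * p * A₁ + b * (1 - p) * A₂ - x) /
                (P[fun ω => ρ ω ^ 2] - p * A₁ ^ 2 - (1 - p) * A₂ ^ 2) * A₂
              - (a * p * A₁ + b * (1 - p) * A₂ - x) /
                (P[fun ω => ρ ω ^ 2] - p * A₁ ^ 2 - (1 - p) * A₂ ^ 2) * ρ ω) ∧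
    (P.real {ω | ρ ω ≤ q} = 1 - p →
      b * P[ρ] - (b - a) / A₁ *
        ((1 - p) * P[fun ω => ρ ω ^ 2] + p ^ 2 * A₁ ^ 2 - (1 - p) ^ 2 * A₂ ^ 2) < x →
      x < b * P[ρ] →
      ∀ X : Ω → ℝ, IsVarianceMinimal P ρ x X₀ X ↔
        X =ᵐ[P] fun ω =>
          if q < ρ ω then
            b - p * (b * P[ρ] - x) /
                ((1 - p) * P[fun ω => ρ ω ^ 2] + p ^ 2 * A₁ ^ 2 - (1 - p) ^ 2 * A₂ ^ 2) * A₁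
              - (1 - p) * (b * P[ρ] - x) /
                ((1 - p) * P[fun ω => ρ ω ^ 2] + p ^ 2 * A₁ ^ 2 - (1 - p) ^ 2 * A₂ ^ 2) * ρ ω
          else
            b + (1 - p) * (b * P[ρ] - x) /
                ((1 - p) * P[fun ω => ρ ω ^ 2] + p ^ 2 * A₁ ^ 2 - (1 - p) ^ 2 * A₂ ^ 2) * A₂
              - (1 - p) * (b * P[ρ] - x) /
                ((1 - p) * P[fun ω => ρ ω ^ 2] + p ^ 2 * A₁ ^ 2 - (1 - p) ^ 2 * A₂ ^ 2) * ρ ω) := by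
  have hρi := hρ.integrable one_le_two
  have hρm := hρi.aemeasurable
  have hp : 0 < 1 - p := sub_pos.2 hp1
  obtain ⟨φ, hφ⟩ : ∃ φ, IsLowerTailWeight P ρ (1 - p) q φ := by
    rw [hq]
    exact exists_isLowerTailWeight hρm (measureReal_lt_leftLim_upperQuantile_le hρm hp)
      (le_measureReal_le_leftLim_upperQuantile hρm (by linarith))
  have hlower : ∀ ψ, IsLowerTailWeight P ρ (1 - p) q ψ → ∫ ω, ψ ω * ρ ω ∂P = (1 - p) * A₂ := by
    intro ψ hψ
    rw [hq] at hψ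
    rw [hA₂, tailMean_lower hρi hp0 hp1 hψ]
  have hE : p * A₁ + (1 - p) * A₂ = ∫ ω, ρ ω ∂P := by
    rw [← hlower φ hφ, hA₁, tailMean_upper hρi hp0 hp1 (hq ▸ hφ)]
    ring
  have hA₂0 : 0 ≤ A₂ := by
    refine le_of_mul_le_mul_left (a := 1 - p) ?_ hp
    rw [mul_zero, ← hlower φ hφ]
    exact integral_nonneg_of_ae (hρpos.mono fun ω hω => mul_nonneg (hφ.nonneg ω) hω.le)
  have hA : A₂ < A₁ := by
    have h := hφ.integral_mul_lt hp (by linarith) hρi fun hc => by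
      rw [variance_congr hc, variance_eq_sub (memLp_const q)] at hρvar
      simp at hρvar
    rw [hlower φ hφ, ← hE] at h
    have := lt_of_mul_lt_mul_left h hp.le
    nlinarith
  have hA₁0 : 0 < A₁ := hA₂0.trans_lt hA
  have hV : Var[ρ; P] = ∫ ω, ρ ω ^ 2 ∂P - (∫ ω, ρ ω ∂P) ^ 2 := by
    rw [variance_eq_sub hρ]
    rfl
  have hm : ∫ ω, X₀ ω ∂P = p * a + (1 - p) * b :=
    (integral_comp_two_point hp0 hp1 hX₀ hX₀law continuous_id).2
  have hE0 : 0 < ∫ ω, ρ ω ∂P := by nlinarith [mul_pos hp0 hA₁0, mul_nonneg hp.le hA₂0]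
  have hAA := sub_pos.2 hA
  have hba := sub_nonneg.2 hab
  rw [hV] at hρvar ⊢
  rw [hm]
  set E := ∫ ω, ρ ω ∂P with hEdef
  set S := ∫ ω, ρ ω ^ 2 ∂P with hSdef
  -- In case (b), `W` is the variance of `ρ` within the two events. There `u` and `v` mark the range
  -- of the slope: the jump is `d = (u - k)(A₁ - A₂)` and the mean multiplier is `(k - (1-p) v) A₁`.
  obtain ⟨W, hW⟩ : ∃ W, W = S - p * A₁ ^ 2 - (1 - p) * A₂ ^ 2 := ⟨_, rfl⟩
  obtain ⟨D, hD⟩ : ∃ D, D = (1 - p) * S + p ^ 2 * A₁ ^ 2 - (1 - p) ^ 2 * A₂ ^ 2 := ⟨_, rfl⟩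
  obtain ⟨u, hu⟩ : ∃ u, u = (b - a) / (A₁ - A₂) := ⟨_, rfl⟩
  obtain ⟨v, hv⟩ : ∃ v, v = (b - a) / A₁ := ⟨_, rfl⟩
  have hu0 : 0 ≤ u := hu ▸ div_nonneg hba hAA.le
  have hv0 : 0 ≤ v := hv ▸ div_nonneg hba hA₁0.le
  have hDW : D = (1 - p) * W + p * A₁ ^ 2 := by
    rw [hD, hW]
    ring
  have hSW : S = W + p * A₁ ^ 2 + (1 - p) * A₂ ^ 2 := by linarith
  simp only [← hD, ← hW, ← hu, ← hv]
  have hu : u * (A₁ - A₂) = b - a := by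
    rw [hu]
    field_simp
  have hv : v * A₁ = b - a := by
    rw [hv]
    field_simp
  refine ⟨fun hx X => ?_, fun hq' h1 h2 X => ?_, fun hq' h1 h2 X => ?_⟩
  · obtain ⟨k, hk⟩ : ∃ k, k = ((p * a + (1 - p) * b) * E - x) / (S - E ^ 2) := ⟨_, rfl⟩
    rw [← hk]
    have hkV : k * (S - E ^ 2) = (p * a + (1 - p) * b) * E - x := by
      rw [hk]
      field_simp
    have huk : u ≤ k := by
      refine le_of_mul_le_mul_right (a := S - E ^ 2) ?_ hρvar
      linarith
    refine isVarianceMinimal_iff_linear hρ hE0 hab hp0 hp1 hX₀ hX₀law hφ (hlower φ hφ)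
      (hu0.trans huk) (by ring) ?_ (by linear_combination -hkV) X
    have := mul_le_mul_of_nonneg_right huk (mul_nonneg hp0.le hAA.le)
    rw [← hE]
    linear_combination this - p * hu
  · have hι := hlower _ (isLowerTailWeight_indicator hρm hq')
    have hW0 : 0 ≤ W := by
      have := two_point_sq_le_integral_sq hρ hq' hι hE
      linarith
    have h1' : a * p * A₁ + b * (1 - p) * A₂ - x < u * W := by
      rw [← hE, hSW] at h1
      linear_combination h1 + p * (1 - p) * (A₁ - A₂) * hu
    have h2' : (1 - p) * v * W ≤ a * p * A₁ + b * (1 - p) * A₂ - x := by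
      rw [← hE, hDW] at h2
      linear_combination h2 - p * A₁ * hv
    -- If `W = 0`, the two bounds on `x` contradict each other.
    have hW1 : 0 < W := by
      refine hW0.lt_of_ne fun h => ?_
      rw [← h] at h1' h2'
      linarith
    obtain ⟨k, hk⟩ : ∃ k, k = (a * p * A₁ + b * (1 - p) * A₂ - x) / W := ⟨_, rfl⟩
    simp only [← hk]
    have hkW : k * W = a * p * A₁ + b * (1 - p) * A₂ - x := by
      rw [hk]
      field_simp
    have hku : k < u := lt_of_mul_lt_mul_right (a := W) (by linarith) hW0
    have hvk : (1 - p) * v ≤ k := le_of_mul_le_mul_right (a := W) (by linarith) hW1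
    have hd : 0 < (u - k) * (A₁ - A₂) := mul_pos (sub_pos.2 hku) hAA
    -- If `v = 0` then `a = b`, so `u = 0` and the range `(1-p) v ≤ k < u` is empty.
    have hv1 : 0 < v := by
      refine hv0.lt_of_ne fun h => ?_
      have hub : u = 0 := by
        have : u * (A₁ - A₂) = 0 := by rw [hu, ← hv, ← h, zero_mul]
        exact (mul_eq_zero.1 this).resolve_right hAA.ne'
      rw [← h] at hvk
      linarith
    refine (isVarianceMinimal_iff_raised (μ := a + k * A₁) (d := b + k * A₂ - (a + k * A₁)) hρ hE0
      hab hp0 hp1 hX₀ hX₀law hq' hι ((mul_pos hp hv1).trans_le hvk) (by linarith) (by ring)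
      ?_ (le_of_eq ?_) (Or.inr ⟨?_, ?_⟩) X).trans (iff_of_eq ?_)
    · rw [← hEdef, ← hSdef, ← hE, hSW]
      linear_combination -hkW
    · rw [← hEdef, ← hE]
      ring
    · have := mul_le_mul_of_nonneg_right hvk hA₁0.le
      rw [← hEdef, ← hE]
      linear_combination this - (1 - p) * hv
    · rw [← hEdef, ← hE]
      ring
    · congr 1
      funext ω
      simp only [raisedPayoff, add_sub_cancel]
  · have hι := hlower _ (isLowerTailWeight_indicator hρm hq')
    have hW0 : 0 ≤ W := by
      have := two_point_sq_le_integral_sq hρ hq' hι hE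
      linarith
    have hD0 : 0 < D := by
      rw [hDW]
      positivity
    obtain ⟨K, hK⟩ : ∃ K, K = (b * E - x) / D := ⟨_, rfl⟩
    simp only [mul_div_assoc, ← hK]
    have hK0 : 0 < K := hK ▸ div_pos (sub_pos.2 h2) hD0
    have hKD : K * D = b * E - x := by
      rw [hK]
      field_simp
    have hKv : K < v := lt_of_mul_lt_mul_right (a := D) (by linarith) hD0.le
    have hKA : K * A₁ ≤ b - a := hv ▸ mul_le_mul_of_nonneg_right hKv.le hA₁0.le
    -- The vanishing mean multiplier forces `d (1-p) = k E[ρ]`, so `k` and `d` are proportional to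
    -- `1-p` and `E[ρ]`; the binding tail then fixes `μ`, and the budget fixes `K`.
    refine (isVarianceMinimal_iff_raised (μ := b - p * K * A₁) (k := (1 - p) * K) (d := K * E)
      hρ hE0 hab hp0 hp1 hX₀ hX₀law hq' hι (mul_pos hp hK0) (mul_pos hK0 hE0) ?_ ?_ ?_
      (Or.inl (by ring)) X).trans (iff_of_eq ?_)
    · rw [← hE]
      ring
    · rw [← hEdef, ← hSdef]
      rw [hD] at hKD
      linear_combination -hKD + K * (p * A₁ - (1 - p) * A₂) * hE
    · have := mul_le_mul_of_nonneg_left hKA hp0.le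
      rw [← hEdef]
      linear_combination this
    · congr 1
      funext ω
      simp only [raisedPayoff, ← hE]
      split_ifs <;> ring
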